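/- Let $(\mu_t)_{t\ge 0}$ be a family of probability measures on $\mathbb{R}$ such that, for every $t>0$, $\mu_t$ has a density $\rho(t,\cdot)\ge 0$ with respect to Lebesgue measure (at $t=0$ a density is allowed but not required), and let $$G(t,z)=\int_{\mathbb{R}}\frac{d\mu_t(x)}{z-x},\qquad t\ge 0,\ z\in\mathbb{C}\setminus\mathbb{R},$$ be its Green's function, so that $G(t,z)=\int_{\mathbb{R}}\frac{\rho(t,x)}{z-x}\,dx$ for $t>0$. Assume the following. [C1] $\rho$ is piecewise differentiable in $(t,x)\in(0,\infty)\times\mathbb{R}$: there is an open set $U\subseteq(0,\infty)\times\mathbb{R}$ (the union of the open pieces), with complement in $(0,\infty)\times\mathbb{R}$ of Lebesgue measure zero, at every point of which $\partial\rho/\partial t$ and $\partial\rho/\partial x$ exist. [C2] For each $t>0$ there is $p\in(1,\infty)$ such that $\rho(t,\cdot)$ and the piecewise-defined derivatives $\frac{\partial\rho}{\partial t}(t,\cdot)$, $\frac{\partial\rho}{\partial x}(t,\cdot)$ (defined at the $x$ with $(t,x)\in U$, and set to $0$ elsewhere) belong to $L^p(\mathbb{R})$. Suppose that $G$ solves the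 complex inviscid Burgers equation $$\frac{\partial G}{\partial t}(t,z)+G(t,z)\,\frac{\partial G}{\partial z}(t,z)=0,\qquad t\ge 0,\ z\in\mathbb{C}\setminus\mathbb{R}$$ (with the one-sided time derivative at $t=0$). Write $$\mathcal{H}[f](x)=\frac1\pi\lim_{\varepsilon\downarrow0}\Big\{\int_{-\infty}^{x-\varepsilon}\frac{f(y)}{x-y}\,dy+\int_{x+\varepsilon}^{\infty}\frac{f(y)}{x-y}\,dy\Big\}$$ for the Hilbert transform. Then: (i) For every $(t,x)\in U$, the principal value $\mathcal{H}[\rho(t,\cdot)](x)$ exists, $y\mapsto\rho(t,y)\,\mathcal{H}[\rho(t,\cdot)](y)$ is differentiable at $x$, and $$\frac{\partial\rho}{\partial t}(t,x)+\pi\,\frac{\partial}{\partial x}\Big\{\rho(t,x)\,\mathcal{H}[\rho(t,\cdot)](x)\Big\}=0.$$ (ii) For all $t\ge0$ and $z\in\mathbb{C}\setminus\mathbb{R}$, the point $z-tG(t,z)$ is not real and $$G(t,z)=G\big(0,\,z-tG(t,z)\big).$$ -/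

import Mathlib

open MeasureTheory Filter Topology Set

noncomputable section

/-- The integral of `y ↦ f y / (x - y)` over `(-∞, x - ε] ∪ [x + ε, ∞)`. -/
def truncatedHilbert (f : ℝ → ℝ) (x ε : ℝ) : ℝ :=
  (∫ y in Iic (x - ε), f y / (x - y)) + ∫ y in Ici (x + ε), f y / (x - y)

/-- The Cauchy principal value that defines the Hilbert transform of `f` at `x` exists and is
finite. -/
def HilbertExistsAt (f : ℝ → ℝ) (x : ℝ) : Prop :=
  (∀ ε > 0, IntegrableOn (fun y => f y / (x - y)) (Iic (x - ε)) ∧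
    IntegrableOn (fun y => f y / (x - y)) (Ici (x + ε))) ∧
  ∃ l : ℝ, Tendsto (truncatedHilbert f x) (𝓝[>] 0) (𝓝 l)

/-- The Hilbert transform `(1 / π) p.v. ∫ f y / (x - y) dy` (meaningful where
`HilbertExistsAt f x` holds). -/
def hilbertTransform (f : ℝ → ℝ) (x : ℝ) : ℝ :=
  (1 / Real.pi) * limUnder (𝓝[>] (0 : ℝ)) (truncatedHilbert f x)

/-- The Green's function (Stieltjes transform) `G(t, z) = ∫ dμ(t, x) / (z - x)`. -/
def greenFunction (μ : ℝ → Measure ℝ) (t : ℝ) (z : ℂ) : ℂ :=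
  ∫ x : ℝ, 1 / (z - (x : ℂ)) ∂(μ t)

/-- `G` solves `∂G/∂t + G ∂G/∂z = 0` for all `t ≥ 0` and `z ∈ ℂ \ ℝ`; the time derivative is
one-sided at `t = 0`, and the `z`-derivative is the complex one. -/
def SolvesComplexBurgers (G : ℝ → ℂ → ℂ) : Prop :=
  ∀ t : ℝ, 0 ≤ t → ∀ z : ℂ, z.im ≠ 0 →
    ∃ Gt Gz : ℂ, HasDerivWithinAt (fun s : ℝ => G s z) Gt (Ici 0) t ∧
      HasDerivAt (G t) Gz z ∧ Gt + G t z * Gz = 0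

/-- `ρ(t, x)` is piecewise differentiable in `t ∈ (0, ∞)` and `x ∈ ℝ`, where `U` is the union of
the open pieces: the pieces fill `(0, ∞) × ℝ` up to a null set (the break points), and on them
both partial derivatives exist. -/
structure PiecewiseDifferentiable (ρ : ℝ → ℝ → ℝ) (U : Set (ℝ × ℝ)) : Prop where
  isOpen : IsOpen U
  subset : U ⊆ Ioi (0 : ℝ) ×ˢ (univ : Set ℝ)
  null_breaks : volume ((Ioi (0 : ℝ) ×ˢ (univ : Set ℝ)) \ U) = 0
  differentiable_time : ∀ t x : ℝ, (t, x) ∈ U → DifferentiableAt ℝ (fun s => ρ s x) t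
  differentiable_space : ∀ t x : ℝ, (t, x) ∈ U → DifferentiableAt ℝ (fun y => ρ t y) x

/-- The piecewise-defined derivative `∂ρ/∂t (t, ·)` (set to `0` at break points). -/
def pwDerivTime (ρ : ℝ → ℝ → ℝ) (U : Set (ℝ × ℝ)) (t : ℝ) : ℝ → ℝ :=
  {x : ℝ | (t, x) ∈ U}.indicator fun x => deriv (fun s => ρ s x) t

/-- The piecewise-defined derivative `∂ρ/∂x (t, ·)` (set to `0` at break points). -/
def pwDerivSpace (ρ : ℝ → ℝ → ℝ) (U : Set (ℝ × ℝ)) (t : ℝ) : ℝ → ℝ :=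
  {x : ℝ | (t, x) ∈ U}.indicator fun x => deriv (fun y => ρ t y) x

/-- For each `t > 0` there is `1 < p < ∞` such that `ρ(t, ·)` and its two piecewise-defined
derivatives lie in `L^p(ℝ)`. -/
def DensityInLp (ρ : ℝ → ℝ → ℝ) (U : Set (ℝ × ℝ)) : Prop :=
  ∀ t : ℝ, 0 < t → ∃ p : ENNReal, 1 < p ∧ p < ⊤ ∧
    MemLp (ρ t) p ∧ MemLp (pwDerivTime ρ U t) p ∧ MemLp (pwDerivSpace ρ U t) p

end

/-!
Write `S_t` for the Stieltjes transform of `μ t`, so that `S_t = G(t, ·)`.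

*Characteristics.* Along the line `s ↦ z + (s - t) S_t(z)` the deviation of `S_s` from its final
value `S_t(z)` satisfies a linear differential equation and vanishes at `s = t`; since `Im S_t` and
`Im z` have opposite signs, the line stays away from the real axis for `0 ≤ s ≤ t`, so Grönwall's
inequality gives `S_t(z) = S_0(z - t S_t(z))` (`stieltjes_eq_stieltjes_zero`). The chain rule
needed here holds although only partial derivatives of `G` are given, because the `z`-dependence is
controlled uniformly in the measure (`norm_stieltjes_taylor_le`).

*Boundary values.* At a point where the density is differentiable, the Plemelj formula
(`tendsto_integral_mul_one_div_add_I_sub`) identifies the limit of `S_t` from above with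
`b = π (H ρ - i ρ)`. The functional equation shows that `w ↦ w + t S_0(w)` sends
`z - t S_t(z)` back to `z`, which bounds `S_t` by a constant depending on `t` only. Where `ρ > 0`,
it passes to the limit as `S_0(x - t b) = b`, with `x - t b` in the open upper half-plane. There
the map `w ↦ w + t S_0(w)` takes each value of the closed half-plane at most once and with nonzero
derivative (`add_mul_stieltjes_inj`, `one_sub_mul_stieltjesSlope_ne_zero`): both facts come from the
strict inequality `re_stieltjesSlope_lt`. Hence `b` is locally the composition of `S_0` with an
inverse function, in `x` and in `t`, and its derivatives satisfy `∂b/∂t + b ∂b/∂x = 0`; the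
imaginary part of this identity is the equation for the density. Where `ρ = 0`, the density has a minimum in both variables
and `H ρ` is bounded nearby, so both terms of the equation vanish.
-/

/-! ### The Stieltjes transform of a probability measure -/

/-- The Stieltjes (Cauchy) transform `z ↦ ∫ dν(x) / (z - x)` of a measure on `ℝ`. -/
noncomputable def stieltjes (ν : Measure ℝ) (z : ℂ) : ℂ := ∫ x : ℝ, 1 / (z - (x : ℂ)) ∂ν

/-- The integral `∫ dν(x) / ((w - x) (z - x))`, which is minus the divided difference of the
Stieltjes transform at `w` and `z`; on the diagonal it is minus its derivative. -/
noncomputable def stieltjesSlope (ν : Measure ℝ) (w z : ℂ) : ℂ :=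
  ∫ x : ℝ, 1 / ((w - (x : ℂ)) * (z - (x : ℂ))) ∂ν

/-- The integral `∫ dν(x) / |z - x|²`. -/
noncomputable def stieltjesEnergy (ν : Measure ℝ) (z : ℂ) : ℝ :=
  ∫ x : ℝ, 1 / Complex.normSq (z - (x : ℂ)) ∂ν

theorem abs_im_le_norm_sub_ofReal (z : ℂ) (x : ℝ) : |z.im| ≤ ‖z - (x : ℂ)‖ := by
  simpa using Complex.abs_im_le_norm (z - (x : ℂ))

theorem sub_ofReal_ne_zero {z : ℂ} (hz : z.im ≠ 0) (x : ℝ) : z - (x : ℂ) ≠ 0 := by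
  intro h
  apply hz
  simpa using congrArg Complex.im h

theorem norm_one_div_sub_ofReal_le {z : ℂ} {d : ℝ} (hd : 0 < d) (hz : d ≤ |z.im|) (x : ℝ) :
    ‖1 / (z - (x : ℂ))‖ ≤ 1 / d := by
  rw [norm_div, norm_one]
  exact one_div_le_one_div_of_le hd (hz.trans (abs_im_le_norm_sub_ofReal z x))

theorem continuous_one_div_sub_ofReal {z : ℂ} (hz : z.im ≠ 0) :
    Continuous fun x : ℝ => 1 / (z - (x : ℂ)) :=
  continuous_const.div (by fun_prop) (sub_ofReal_ne_zero hz)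

/-- Strict form of the inequality between the geometric and the arithmetic mean; it is strict
because `a` is not the conjugate of `b`. -/
theorem re_one_div_mul_lt {a b : ℂ} (ha : 0 < a.im) (hb : 0 < b.im) :
    (1 / (a * b)).re < (1 / Complex.normSq a + 1 / Complex.normSq b) / 2 := by
  have hA : 0 < Complex.normSq a := by
    rw [Complex.normSq_apply]; nlinarith [mul_self_nonneg a.re]
  have hB : 0 < Complex.normSq b := by
    rw [Complex.normSq_apply]; nlinarith [mul_self_nonneg b.re]
  have e : (1 / (a * b)).re
      = (a.re * b.re - a.im * b.im) / (Complex.normSq a * Complex.normSq b) := by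
    rw [one_div, Complex.inv_re, Complex.normSq_mul, Complex.mul_re]
  rw [e, div_add_div _ _ hA.ne' hB.ne', div_div, div_lt_div_iff₀ (by positivity) (by positivity)]
  have : 2 * (a.re * b.re - a.im * b.im) < Complex.normSq a + Complex.normSq b := by
    rw [Complex.normSq_apply, Complex.normSq_apply]
    nlinarith [sq_nonneg (a.re - b.re), mul_self_nonneg (a.im + b.im), mul_pos ha hb]
  nlinarith [mul_pos hA hB]

theorem one_div_normSq_eq_norm_sq (a : ℂ) : 1 / Complex.normSq a = ‖1 / (a * a)‖ := by
  rw [norm_div, norm_one, norm_mul, Complex.norm_mul_self_eq_normSq]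

theorem stieltjesEnergy_nonneg {ν : Measure ℝ} (z : ℂ) : 0 ≤ stieltjesEnergy ν z :=
  integral_nonneg fun x => by simpa using Complex.normSq_nonneg (z - x)

section Probability

variable {ν : Measure ℝ} [IsProbabilityMeasure ν]

theorem integrable_one_div_sub_ofReal {z : ℂ} (hz : z.im ≠ 0) :
    Integrable (fun x : ℝ => 1 / (z - (x : ℂ))) ν :=
  Integrable.of_bound (continuous_one_div_sub_ofReal hz).aestronglyMeasurable _
    (.of_forall (norm_one_div_sub_ofReal_le (abs_pos.2 hz) le_rfl))

theorem integrable_one_div_sub_mul_sub {w z : ℂ} (hw : w.im ≠ 0) (hz : z.im ≠ 0) :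
    Integrable (fun x : ℝ => 1 / ((w - (x : ℂ)) * (z - (x : ℂ)))) ν := by
  have h := (integrable_one_div_sub_ofReal (ν := ν) hz).bdd_mul
    (f := fun x : ℝ => 1 / (w - (x : ℂ)))
    (continuous_one_div_sub_ofReal hw).aestronglyMeasurable
    (.of_forall (norm_one_div_sub_ofReal_le (abs_pos.2 hw) le_rfl))
  refine h.congr (.of_forall fun x => ?_)
  simp only [one_div, mul_inv]

theorem integrable_one_div_normSq {z : ℂ} (hz : z.im ≠ 0) :
    Integrable (fun x : ℝ => 1 / Complex.normSq (z - (x : ℂ))) ν := by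
  simp_rw [one_div_normSq_eq_norm_sq]
  exact (integrable_one_div_sub_mul_sub hz hz).norm

theorem stieltjes_sub {w z : ℂ} (hw : w.im ≠ 0) (hz : z.im ≠ 0) :
    stieltjes ν w - stieltjes ν z = -(w - z) * stieltjesSlope ν w z := by
  rw [stieltjes, stieltjes, stieltjesSlope, ← integral_sub (integrable_one_div_sub_ofReal hw)
    (integrable_one_div_sub_ofReal hz), ← integral_const_mul]
  refine integral_congr_ae (.of_forall fun x => ?_)
  have h1 := sub_ofReal_ne_zero hw x
  have h2 := sub_ofReal_ne_zero hz x
  simp only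
  field_simp
  ring

/-- Second order Taylor estimate for the Stieltjes transform, uniform in the measure. -/
theorem norm_stieltjes_taylor_le {w z : ℂ} {d : ℝ} (hd : 0 < d) (hw : d ≤ |w.im|)
    (hz : d ≤ |z.im|) :
    ‖stieltjes ν w - stieltjes ν z + (w - z) * stieltjesSlope ν z z‖ ≤ ‖w - z‖ ^ 2 / d ^ 3 := by
  have hw0 : w.im ≠ 0 := abs_pos.1 (hd.trans_le hw)
  have hz0 : z.im ≠ 0 := abs_pos.1 (hd.trans_le hz)
  rw [stieltjes_sub hw0 hz0,
    show -(w - z) * stieltjesSlope ν w z + (w - z) * stieltjesSlope ν z z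
      = (w - z) * (stieltjesSlope ν z z - stieltjesSlope ν w z) by ring,
    stieltjesSlope, stieltjesSlope, ← integral_sub (integrable_one_div_sub_mul_sub hz0 hz0)
    (integrable_one_div_sub_mul_sub hw0 hz0), ← integral_const_mul]
  refine (norm_integral_le_of_norm_le_const (C := ‖w - z‖ ^ 2 / d ^ 3)
    (.of_forall fun x => ?_)).trans (by simp)
  have h1 := sub_ofReal_ne_zero hw0 x
  have h2 := sub_ofReal_ne_zero hz0 x
  have e : (w - z) * (1 / ((z - (x : ℂ)) * (z - x)) - 1 / ((w - (x : ℂ)) * (z - x)))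
      = (w - z) ^ 2 * (1 / (w - (x : ℂ)) * (1 / (z - (x : ℂ)) * (1 / (z - (x : ℂ))))) := by
    field_simp
    ring
  have b1 := norm_one_div_sub_ofReal_le hd hw x
  have b2 := norm_one_div_sub_ofReal_le hd hz x
  rw [e, norm_mul, norm_mul, norm_mul, norm_pow,
    show ‖w - z‖ ^ 2 / d ^ 3 = ‖w - z‖ ^ 2 * (1 / d * (1 / d * (1 / d))) by
      field_simp]
  gcongr

theorem norm_stieltjesSlope_self_le {z : ℂ} {d : ℝ} (hd : 0 < d) (hz : d ≤ |z.im|) :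
    ‖stieltjesSlope ν z z‖ ≤ 1 / d ^ 2 := by
  refine (norm_integral_le_of_norm_le_const (C := 1 / d ^ 2)
    (.of_forall fun x => ?_)).trans (by simp)
  have b2 := norm_one_div_sub_ofReal_le hd hz x
  rw [← one_div_mul_one_div, norm_mul, show 1 / d ^ 2 = 1 / d * (1 / d) by ring]
  gcongr

theorem hasDerivAt_stieltjes {z : ℂ} (hz : z.im ≠ 0) :
    HasDerivAt (stieltjes ν) (-stieltjesSlope ν z z) z := by
  have hd : 0 < |z.im| / 2 := by positivity
  rw [hasDerivAt_iff_isLittleO]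
  have hev : ∀ᶠ w in 𝓝 z, |z.im| / 2 ≤ |w.im| := by
    have : Tendsto (fun w : ℂ => |w.im|) (𝓝 z) (𝓝 |z.im|) :=
      (Complex.continuous_im.abs).tendsto z
    exact (this.eventually (lt_mem_nhds (by linarith [abs_pos.2 hz]))).mono fun _ h => h.le
  have hO : (fun w => stieltjes ν w - stieltjes ν z - (w - z) • -stieltjesSlope ν z z)
      =O[𝓝 z] fun w => (w - z) ^ 2 := by
    refine Asymptotics.IsBigO.of_bound (1 / (|z.im| / 2) ^ 3) (hev.mono fun w hw => ?_)
    have := norm_stieltjes_taylor_le (ν := ν) hd hw (show |z.im| / 2 ≤ |z.im| by linarith)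
    rw [smul_eq_mul, mul_neg, sub_neg_eq_add, norm_pow]
    exact this.trans (le_of_eq (by ring))
  refine hO.trans_isLittleO ?_
  refine Asymptotics.IsLittleO.of_norm_left ?_
  simp_rw [norm_pow]
  exact Asymptotics.isLittleO_pow_sub_sub z (m := 2) (by norm_num)

theorem hasStrictDerivAt_stieltjes {z : ℂ} (hz : 0 < z.im) :
    HasStrictDerivAt (stieltjes ν) (-stieltjesSlope ν z z) z := by
  have hd : DifferentiableOn ℂ (stieltjes ν) {w | 0 < w.im} := fun w hw =>
    (hasDerivAt_stieltjes (ν := ν) (ne_of_gt hw)).differentiableAt.differentiableWithinAt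
  have ho : IsOpen {w : ℂ | 0 < w.im} := isOpen_lt continuous_const Complex.continuous_im
  have := (hd.analyticAt (ho.mem_nhds hz)).hasStrictDerivAt
  rwa [(hasDerivAt_stieltjes hz.ne').deriv] at this

theorem stieltjes_im {z : ℂ} (hz : z.im ≠ 0) :
    (stieltjes ν z).im = -z.im * stieltjesEnergy ν z := by
  have h := integral_im (integrable_one_div_sub_ofReal (ν := ν) hz)
  simp only [RCLike.im_to_complex] at h
  rw [stieltjes, ← h, stieltjesEnergy, ← integral_const_mul]
  refine integral_congr_ae (.of_forall fun x => ?_)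
  simp [Complex.inv_im, div_eq_mul_inv]

theorem norm_stieltjes_le_energy {z : ℂ} (hz : z.im ≠ 0) :
    ‖stieltjes ν z‖ ≤ (1 + stieltjesEnergy ν z) / 2 := by
  have h : (1 + stieltjesEnergy ν z) / 2
      = ∫ x : ℝ, (1 + 1 / Complex.normSq (z - (x : ℂ))) / 2 ∂ν := by
    rw [integral_div, integral_add (integrable_const _) (integrable_one_div_normSq hz)]
    simp [stieltjesEnergy]
  rw [h]
  refine norm_integral_le_of_norm_le
    (((integrable_const _).add (integrable_one_div_normSq hz)).div_const _)
    (.of_forall fun x => ?_)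
  rw [one_div_normSq_eq_norm_sq, ← one_div_mul_one_div, norm_mul]
  nlinarith [sq_nonneg (‖1 / (z - (x : ℂ))‖ - 1)]

theorem re_stieltjesSlope_lt {w z : ℂ} (hw : 0 < w.im) (hz : 0 < z.im) :
    (stieltjesSlope ν w z).re < (stieltjesEnergy ν w + stieltjesEnergy ν z) / 2 := by
  have h := integral_re (integrable_one_div_sub_mul_sub (ν := ν) hw.ne' hz.ne')
  simp only [RCLike.re_to_complex] at h
  have i1 := (integrable_one_div_normSq (ν := ν) hw.ne')
  have i2 := (integrable_one_div_normSq (ν := ν) hz.ne')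
  have i3 := (integrable_one_div_sub_mul_sub (ν := ν) hw.ne' hz.ne').re
  simp only [RCLike.re_to_complex] at i3
  have i4 : Integrable (fun x : ℝ => (1 / Complex.normSq (w - (x : ℂ))
    + 1 / Complex.normSq (z - (x : ℂ))) / 2) ν := (i1.add i2).div_const 2
  rw [stieltjesSlope, ← h, stieltjesEnergy, stieltjesEnergy, ← integral_add i1 i2, ← integral_div]
  rw [← sub_pos, ← integral_sub i4 i3]
  have hp : ∀ x : ℝ, 0 < (1 / Complex.normSq (w - (x : ℂ))
      + 1 / Complex.normSq (z - (x : ℂ))) / 2 - (1 / ((w - (x : ℂ)) * (z - (x : ℂ)))).re :=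
    fun x => sub_pos.2 (re_one_div_mul_lt (by simpa using hw) (by simpa using hz))
  rw [integral_pos_iff_support_of_nonneg (fun x => (hp x).le) (i4.sub i3)]
  rw [show (Function.support fun x : ℝ => (1 / Complex.normSq (w - (x : ℂ))
      + 1 / Complex.normSq (z - (x : ℂ))) / 2 - (1 / ((w - (x : ℂ)) * (z - (x : ℂ)))).re) = univ
    from eq_univ_of_forall fun x => (hp x).ne']
  simp

/-! ### The map `w ↦ w + t S(w)` on the upper half-plane -/

/-- The energy bound on the part of the upper half-plane that `w ↦ w + t S(w)` sends to the closed
upper half-plane. -/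
theorem mul_stieltjesEnergy_le_one {w : ℂ} {t : ℝ} (hw : 0 < w.im)
    (h : 0 ≤ (w + t * stieltjes ν w).im) : t * stieltjesEnergy ν w ≤ 1 := by
  have h2 := stieltjes_im (ν := ν) hw.ne'
  simp only [Complex.add_im, Complex.im_ofReal_mul, h2] at h
  have : 0 ≤ w.im * (1 - t * stieltjesEnergy ν w) := by linarith
  linarith [nonneg_of_mul_nonneg_right this hw]

theorem re_mul_stieltjesSlope_lt_one {w z : ℂ} {t : ℝ} (ht : 0 < t) (hw : 0 < w.im)
    (hz : 0 < z.im) (h1 : 0 ≤ (w + t * stieltjes ν w).im)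
    (h2 : 0 ≤ (z + t * stieltjes ν z).im) : (t * stieltjesSlope ν w z).re < 1 := by
  have := re_stieltjesSlope_lt (ν := ν) hw hz
  rw [Complex.re_ofReal_mul]
  nlinarith [mul_stieltjesEnergy_le_one hw h1, mul_stieltjesEnergy_le_one hz h2]

/-- A point of the closed upper half-plane has at most one preimage in the upper half-plane. -/
theorem add_mul_stieltjes_inj {w z : ℂ} {t : ℝ} (ht : 0 < t) (hw : 0 < w.im) (hz : 0 < z.im)
    (h : w + t * stieltjes ν w = z + t * stieltjes ν z)
    (him : 0 ≤ (w + t * stieltjes ν w).im) : w = z := by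
  by_contra hne
  have hs := stieltjes_sub (ν := ν) hw.ne' hz.ne'
  have h1 : (w - z) * (1 - t * stieltjesSlope ν w z) = 0 := by
    linear_combination h - (t : ℂ) * hs
  have h2 : (1 : ℂ) - t * stieltjesSlope ν w z = 0 :=
    (mul_eq_zero.1 h1).resolve_left (sub_ne_zero.2 hne)
  have h3 := re_mul_stieltjesSlope_lt_one ht hw hz him (h ▸ him)
  rw [← sub_eq_zero.1 h2] at h3
  simp at h3

theorem one_sub_mul_stieltjesSlope_ne_zero {w : ℂ} {t : ℝ} (ht : 0 < t) (hw : 0 < w.im)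
    (him : 0 ≤ (w + t * stieltjes ν w).im) : 1 - t * stieltjesSlope ν w w ≠ 0 := by
  intro h
  have h3 := re_mul_stieltjesSlope_lt_one ht hw hw him him
  rw [← sub_eq_zero.1 h] at h3
  simp at h3

theorem norm_stieltjes_le_of_im_nonneg {w : ℂ} {t : ℝ} (ht : 0 < t) (hw : 0 < w.im)
    (him : 0 ≤ (w + t * stieltjes ν w).im) : ‖stieltjes ν w‖ ≤ (1 + 1 / t) / 2 := by
  have h1 := norm_stieltjes_le_energy (ν := ν) hw.ne'
  have h2 : stieltjesEnergy ν w ≤ 1 / t := by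
    rw [le_div_iff₀ ht, mul_comm]
    exact mul_stieltjesEnergy_le_one hw him
  linarith

end Probability

/-! ### Characteristics of the complex Burgers equation -/

section Characteristics

variable {μ : ℝ → Measure ℝ}

theorem greenFunction_eq_stieltjes (t : ℝ) (z : ℂ) :
    greenFunction μ t z = stieltjes (μ t) z := rfl

theorem hasDerivWithinAt_stieltjes_time (hμ : ∀ t : ℝ, 0 ≤ t → IsProbabilityMeasure (μ t))
    (hG : SolvesComplexBurgers (greenFunction μ)) {t : ℝ} (ht : 0 ≤ t) {z : ℂ} (hz : z.im ≠ 0) :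
    HasDerivWithinAt (fun s => stieltjes (μ s) z)
      (stieltjes (μ t) z * stieltjesSlope (μ t) z z) (Ici 0) t := by
  obtain ⟨Gt, Gz, h1, h2, h3⟩ := hG t ht z hz
  have := hμ t ht
  have h4 : Gz = -stieltjesSlope (μ t) z z := h2.unique (hasDerivAt_stieltjes hz)
  have h5 : Gt = stieltjes (μ t) z * stieltjesSlope (μ t) z z := by
    rw [h4, greenFunction_eq_stieltjes] at h3
    linear_combination h3
  exact h5 ▸ h1

/-- Continuity in time of the transform passes to its `z`-derivative, which is a locally uniform
limit of difference quotients. -/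
theorem continuousWithinAt_stieltjesSlope (hμ : ∀ t : ℝ, 0 ≤ t → IsProbabilityMeasure (μ t))
    (hc : ∀ z : ℂ, z.im ≠ 0 → ∀ t : ℝ, 0 ≤ t →
      ContinuousWithinAt (fun s => stieltjes (μ s) z) (Ici 0) t)
    {t : ℝ} (ht : 0 ≤ t) {z : ℂ} (hz : z.im ≠ 0) :
    ContinuousWithinAt (fun s => stieltjesSlope (μ s) z z) (Ici 0) t := by
  have hd : 0 < |z.im| := abs_pos.2 hz
  refine continuousWithinAt_of_locally_uniform_approx_of_continuousWithinAt ht fun u hu => ?_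
  obtain ⟨ε, hε, hεu⟩ := Metric.mem_uniformity_dist.1 hu
  -- a horizontal increment keeps the distance to the real axis
  obtain ⟨δ, hδ, hδε⟩ : ∃ δ : ℝ, 0 < δ ∧ δ / |z.im| ^ 3 < ε :=
    ⟨ε * |z.im| ^ 3 / 2, by positivity, by
      rw [div_lt_iff₀ (by positivity)]
      have : 0 < ε * |z.im| ^ 3 := by positivity
      linarith⟩
  have him : (z + δ).im = z.im := by simp
  refine ⟨Ici 0, self_mem_nhdsWithin,
    fun s => -(stieltjes (μ s) (z + δ) - stieltjes (μ s) z) / δ,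
    (((hc _ (him ▸ hz) t ht).sub (hc z hz t ht)).neg.div_const _), fun s hs => hεu ?_⟩
  have := hμ s hs
  have hT := norm_stieltjes_taylor_le (ν := μ s) (w := z + δ) (z := z) hd (him ▸ le_rfl) le_rfl
  have hδ0 : (δ : ℂ) ≠ 0 := by exact_mod_cast hδ.ne'
  have hn : ‖(δ : ℂ)‖ = δ := by simp [abs_of_pos hδ]
  rw [add_sub_cancel_left, hn] at hT
  rw [dist_eq_norm, show stieltjesSlope (μ s) z z
      - -(stieltjes (μ s) (z + δ) - stieltjes (μ s) z) / δ
      = (stieltjes (μ s) (z + δ) - stieltjes (μ s) z + δ * stieltjesSlope (μ s) z z) / δ by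
    field_simp; ring, norm_div, hn, div_lt_iff₀ hδ]
  calc _ ≤ _ := hT
    _ = δ / |z.im| ^ 3 * δ := by ring
    _ < ε * δ := by gcongr

/-- The chain rule along the line through `z` with slope `c`. -/
theorem hasDerivWithinAt_stieltjes_line (hμ : ∀ t : ℝ, 0 ≤ t → IsProbabilityMeasure (μ t))
    (hG : SolvesComplexBurgers (greenFunction μ)) {t : ℝ} (ht : 0 ≤ t) {z : ℂ} (hz : z.im ≠ 0)
    (c : ℂ) :
    HasDerivWithinAt (fun s : ℝ => stieltjes (μ s) (z + ((s - t : ℝ) : ℂ) * c))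
      (stieltjesSlope (μ t) z z * (stieltjes (μ t) z - c)) (Ici 0) t := by
  have hslope := continuousWithinAt_stieltjesSlope hμ
    (fun w hw s hs => (hasDerivWithinAt_stieltjes_time hμ hG hs hw).continuousWithinAt) ht hz
  have htime := hasDerivWithinAt_stieltjes_time hμ hG ht hz
  rw [hasDerivWithinAt_iff_isLittleO] at htime ⊢
  have hd : 0 < |z.im| / 2 := by have := abs_pos.2 hz; positivity
  have hsq : (fun s : ℝ => stieltjes (μ s) (z + ((s - t : ℝ) : ℂ) * c) - stieltjes (μ s) z
      + ((s - t : ℝ) : ℂ) * c * stieltjesSlope (μ s) z z) =o[𝓝[Ici 0] t] fun s => s - t := by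
    have hO : (fun s : ℝ => stieltjes (μ s) (z + ((s - t : ℝ) : ℂ) * c) - stieltjes (μ s) z
      + ((s - t : ℝ) : ℂ) * c * stieltjesSlope (μ s) z z) =O[𝓝[Ici 0] t]
        fun s => ‖s - t‖ ^ 2 := by
      have hev : ∀ᶠ s : ℝ in 𝓝[Ici 0] t, |z.im| / 2 ≤ |(z + ((s - t : ℝ) : ℂ) * c).im| := by
        have : Continuous fun s : ℝ => |(z + ((s - t : ℝ) : ℂ) * c).im| := by fun_prop
        have h2 := this.tendsto t
        simp only [sub_self, Complex.ofReal_zero, zero_mul, add_zero] at h2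
        exact ((h2.mono_left nhdsWithin_le_nhds).eventually
          (lt_mem_nhds (by linarith [abs_pos.2 hz]))).mono fun _ h => h.le
      refine Asymptotics.IsBigO.of_bound (‖c‖ ^ 2 / (|z.im| / 2) ^ 3) ?_
      filter_upwards [hev, self_mem_nhdsWithin] with s hs hs0
      have := hμ s hs0
      have hT := norm_stieltjes_taylor_le (ν := μ s) hd hs (show |z.im| / 2 ≤ |z.im| by linarith)
      rw [add_sub_cancel_left] at hT
      refine hT.trans (le_of_eq ?_)
      rw [norm_mul, Complex.norm_real, norm_pow, norm_norm]
      ring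
    exact hO.trans_isLittleO
      ((Asymptotics.isLittleO_pow_sub_sub t (m := 2) (by norm_num)).mono nhdsWithin_le_nhds)
  have hmid : (fun s : ℝ => (s - t) • (-c * (stieltjesSlope (μ s) z z - stieltjesSlope (μ t) z z)))
      =o[𝓝[Ici 0] t] fun s => s - t := by
    have h0 : Tendsto (fun s : ℝ => -c * (stieltjesSlope (μ s) z z - stieltjesSlope (μ t) z z))
        (𝓝[Ici 0] t) (𝓝 0) := by
      have := (hslope.tendsto.sub_const (stieltjesSlope (μ t) z z)).const_mul (-c)
      simpa using this
    have := (Asymptotics.isBigO_refl (fun s : ℝ => s - t) (𝓝[Ici 0] t)).smul_isLittleO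
      ((Asymptotics.isLittleO_one_iff ℝ).2 h0)
    simpa using this
  refine ((htime.add hmid).add hsq).congr_left fun s => ?_
  simp only [sub_self, Complex.ofReal_zero, zero_mul, add_zero, Complex.real_smul]
  ring

/-- Backward characteristics move away from the real axis. -/
theorem abs_im_le_abs_im_characteristic {ν : Measure ℝ} [IsProbabilityMeasure ν] {z : ℂ}
    (hz : z.im ≠ 0) {r : ℝ} (hr : 0 ≤ r) :
    |z.im| ≤ |(z - r * stieltjes ν z).im| := by
  have hE : 0 ≤ stieltjesEnergy ν z := stieltjesEnergy_nonneg z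
  have : (z - r * stieltjes ν z).im = z.im * (1 + r * stieltjesEnergy ν z) := by
    rw [Complex.sub_im, Complex.im_ofReal_mul, stieltjes_im hz]
    ring
  rw [this, abs_mul]
  have h1 : 1 ≤ |1 + r * stieltjesEnergy ν z| :=
    (le_add_of_nonneg_right (mul_nonneg hr hE)).trans (le_abs_self _)
  nlinarith [abs_nonneg z.im]

/-- The transform is constant along characteristics: its deviation from the final value solves a
linear equation and vanishes at the final time. -/
theorem stieltjes_eq_stieltjes_zero (hμ : ∀ t : ℝ, 0 ≤ t → IsProbabilityMeasure (μ t))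
    (hG : SolvesComplexBurgers (greenFunction μ)) {t : ℝ} (ht : 0 ≤ t) {z : ℂ} (hz : z.im ≠ 0) :
    stieltjes (μ t) z = stieltjes (μ 0) (z - t * stieltjes (μ t) z) := by
  have := hμ t ht
  set c := stieltjes (μ t) z with hc
  set h : ℝ → ℂ := fun s => stieltjes (μ s) (z + ((s - t : ℝ) : ℂ) * c) - c with hh
  have him : ∀ s ≤ t, |z.im| ≤ |(z + ((s - t : ℝ) : ℂ) * c).im| := fun s hs => by
    have := abs_im_le_abs_im_characteristic (ν := μ t) hz (sub_nonneg.2 hs)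
    rwa [← hc, show z - ((t - s : ℝ) : ℂ) * c = z + ((s - t : ℝ) : ℂ) * c by
      push_cast; ring] at this
  have hne : ∀ s ≤ t, (z + ((s - t : ℝ) : ℂ) * c).im ≠ 0 := fun s hs =>
    abs_pos.1 ((abs_pos.2 hz).trans_le (him s hs))
  have hder : ∀ s, 0 ≤ s → s ≤ t → HasDerivWithinAt h
      (stieltjesSlope (μ s) (z + ((s - t : ℝ) : ℂ) * c) (z + ((s - t : ℝ) : ℂ) * c) * h s)
      (Ici 0) s := fun s hs0 hst => by
    have h1 := (hasDerivWithinAt_stieltjes_line hμ hG hs0 (hne s hst) c).sub_const c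
    refine h1.congr_of_eventuallyEq (.of_forall fun r => ?_) ?_
    · simp only [hh]
      congr 2
      push_cast
      ring
    · simp [hh]
  have hback : ∀ r ∈ Icc 0 t, ‖h (t - r)‖ = 0 := by
    have key := norm_le_gronwallBound_of_norm_deriv_right_le (f := fun r => h (t - r))
      (f' := fun r => -(stieltjesSlope (μ (t - r)) (z + ((t - r - t : ℝ) : ℂ) * c)
        (z + ((t - r - t : ℝ) : ℂ) * c) * h (t - r)))
      (δ := 0) (K := 1 / |z.im| ^ 2) (ε := 0) (a := 0) (b := t) ?_ ?_ ?_ ?_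
    · intro r hr
      have := key r hr
      rw [gronwallBound_ε0, zero_mul] at this
      exact le_antisymm this (norm_nonneg _)
    · have hcont : ContinuousOn h (Icc 0 t) := fun s hs =>
        (hder s hs.1 hs.2).continuousWithinAt.mono Icc_subset_Ici_self
      exact hcont.comp (by fun_prop) fun r hr => ⟨by linarith [hr.2], by linarith [hr.1]⟩
    · intro r hr
      have h1 := (hder (t - r) (by linarith [hr.2]) (by linarith [hr.1])).hasDerivAt
        (Ici_mem_nhds (by linarith [hr.2]))
      exact (h1.comp_const_sub t r).hasDerivWithinAt
    · simp [hh, hc]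
    · intro r hr
      have := hμ (t - r) (by linarith [hr.2])
      rw [norm_neg, norm_mul, add_zero]
      gcongr
      exact norm_stieltjesSlope_self_le (abs_pos.2 hz) (him _ (by linarith [hr.1]))
  have h0 := norm_eq_zero.1 (hback t ⟨ht, le_rfl⟩)
  simp only [hh, sub_self, zero_sub] at h0
  rw [eq_comm, ← sub_eq_zero, ← h0]
  congr 2
  push_cast
  ring

end Characteristics

/-! ### The Plemelj formula at a point of differentiability -/

section Plemelj

variable {f : ℝ → ℝ} {x : ℝ}

theorem integrableOn_div_sub_of_le_abs (hf : Integrable f) {ε : ℝ} (hε : 0 < ε) {s : Set ℝ}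
    (hs : MeasurableSet s) (h : ∀ y ∈ s, ε ≤ |x - y|) :
    IntegrableOn (fun y => f y / (x - y)) s := by
  have hm : AEStronglyMeasurable (fun y => f y / (x - y)) (volume.restrict s) :=
    (hf.aemeasurable.div (by fun_prop)).aestronglyMeasurable.restrict
  refine (hf.norm.div_const ε).integrableOn.mono' hm ?_
  filter_upwards [ae_restrict_mem hs] with y hy
  rw [norm_div]
  exact div_le_div_of_nonneg_left (norm_nonneg _) hε (h y hy)

theorem Iic_union_Ici_eq_le_abs_sub (ε : ℝ) :
    Iic (x - ε) ∪ Ici (x + ε) = {y | ε ≤ |x - y|} := by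
  ext y
  simp only [mem_union, mem_Iic, mem_Ici, mem_ofPred_eq, le_abs]
  constructor <;> rintro (h | h) <;> [left; right; left; right] <;> linarith

theorem truncatedHilbert_eq_setIntegral (hf : Integrable f) {ε : ℝ} (hε : 0 < ε) :
    truncatedHilbert f x ε = ∫ y in {y | ε ≤ |x - y|}, f y / (x - y) := by
  rw [← Iic_union_Ici_eq_le_abs_sub ε, setIntegral_union ?_ measurableSet_Ici
    (integrableOn_div_sub_of_le_abs hf hε measurableSet_Iic fun y hy => ?_)
    (integrableOn_div_sub_of_le_abs hf hε measurableSet_Ici fun y hy => ?_), truncatedHilbert]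
  · exact Set.disjoint_left.2 fun y h1 h2 => by
      simp only [mem_Iic, mem_Ici] at h1 h2; linarith
  · exact le_abs.2 (Or.inl (by simp only [mem_Iic] at hy; linarith))
  · exact le_abs.2 (Or.inr (by simp only [mem_Ici] at hy; linarith))

/-- `f` minus the constant `f x` on a window around `x`. Its quotient by `x - y` is integrable when
`f` is differentiable at `x`, while the symmetric window contributes nothing to the principal
value. -/
noncomputable def windowRemainder (f : ℝ → ℝ) (x : ℝ) (y : ℝ) : ℝ :=
  f y - (Icc (x - 1) (x + 1)).indicator (fun _ => f x) y

theorem integrable_window (c : ℝ) :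
    Integrable ((Icc (x - 1) (x + 1)).indicator fun _ => c) :=
  (integrable_indicator_iff measurableSet_Icc).2 (by simp [IntegrableOn])

theorem integrable_windowRemainder (hf : Integrable f) : Integrable (windowRemainder f x) :=
  hf.sub (integrable_window _)

theorem windowRemainder_self : windowRemainder f x x = 0 := by
  rw [windowRemainder, indicator_of_mem (by constructor <;> linarith), sub_self]

theorem integrable_windowRemainder_div (hf : Integrable f) (hx : DifferentiableAt ℝ f x) :
    Integrable fun y => windowRemainder f x y / (x - y) := by
  obtain ⟨C, hC⟩ := hx.isBigO_sub.bound
  obtain ⟨δ, hδ, hδC⟩ := Metric.eventually_nhds_iff.1 hC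
  have hr := integrable_windowRemainder (x := x) hf
  have hm : AEStronglyMeasurable (fun y => windowRemainder f x y / (x - y)) :=
    (hr.aemeasurable.div (by fun_prop)).aestronglyMeasurable
  have hδ' : 0 < min δ 1 := lt_min hδ one_pos
  refine ((integrable_window (x := x) |C|).add (hr.norm.div_const (min δ 1))).mono' hm
    (.of_forall fun y => ?_)
  simp only [Pi.add_apply]
  rw [norm_div]
  have h0 : 0 ≤ (Icc (x - 1) (x + 1)).indicator (fun _ => |C|) y :=
    indicator_nonneg (fun _ _ => abs_nonneg C) y
  by_cases hy : |x - y| < min δ 1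
  · have hy1 := abs_lt.1 (hy.trans_le (min_le_right _ _))
    have hmem : y ∈ Icc (x - 1) (x + 1) := ⟨by linarith, by linarith⟩
    have hb : ‖f y - f x‖ ≤ C * ‖y - x‖ :=
      hδC (by rw [dist_comm, Real.dist_eq]; exact hy.trans_le (min_le_left _ _))
    rw [indicator_of_mem hmem]
    have h1 : ‖windowRemainder f x y‖ / ‖x - y‖ ≤ |C| := by
      rw [windowRemainder, indicator_of_mem hmem]
      refine div_le_of_le_mul₀ (norm_nonneg _) (abs_nonneg _) (hb.trans ?_)
      rw [norm_sub_rev]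
      gcongr
      exact le_abs_self C
    have : 0 ≤ ‖windowRemainder f x y‖ / min δ 1 := by positivity
    linarith
  · have h1 : ‖windowRemainder f x y‖ / ‖x - y‖ ≤ ‖windowRemainder f x y‖ / min δ 1 :=
      div_le_div_of_nonneg_left (norm_nonneg _) hδ' (not_lt.1 hy)
    linarith

theorem setIntegral_window_div_eq_zero (c ε : ℝ) :
    ∫ y in {y | ε ≤ |x - y|}, (Icc (x - 1) (x + 1)).indicator (fun _ => c) y / (x - y) = 0 := by
  have hms : MeasurableSet {y : ℝ | ε ≤ |x - y|} := measurableSet_le (by fun_prop) (by fun_prop)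
  rw [← integral_indicator hms]
  set J := {y : ℝ | ε ≤ |x - y|}.indicator
    fun y => (Icc (x - 1) (x + 1)).indicator (fun _ => c) y / (x - y) with hJ
  -- the integrand is odd about `x`
  have hodd : ∀ y, J (2 * x - y) = -J y := fun y => by
    have e1 : x - (2 * x - y) = -(x - y) := by ring
    have e2 : 2 * x - y ∈ Icc (x - 1) (x + 1) ↔ y ∈ Icc (x - 1) (x + 1) := by
      simp only [mem_Icc]; constructor <;> rintro ⟨h1, h2⟩ <;> constructor <;> linarith
    simp only [hJ, indicator_apply, mem_ofPred_eq, e1, abs_neg, e2]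
    split_ifs <;> simp only [div_neg, zero_div, neg_zero]
  have h := integral_sub_left_eq_self J volume (2 * x)
  simp_rw [hodd, integral_neg] at h
  linarith

theorem tendsto_truncatedHilbert (hf : Integrable f) (hx : DifferentiableAt ℝ f x) :
    Tendsto (truncatedHilbert f x) (𝓝[>] 0) (𝓝 (∫ y, windowRemainder f x y / (x - y))) := by
  have hq := integrable_windowRemainder_div hf hx
  have hms : ∀ ε, MeasurableSet {y : ℝ | ε ≤ |x - y|} := fun ε =>
    measurableSet_le (by fun_prop) (by fun_prop)
  have heq : ∀ ε ∈ Ioi (0 : ℝ),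
      ∫ y, {y | ε ≤ |x - y|}.indicator (fun y => windowRemainder f x y / (x - y)) y
        = truncatedHilbert f x ε := fun ε hε => by
    rw [integral_indicator (hms ε), truncatedHilbert_eq_setIntegral hf hε]
    have e : ∀ y, f y / (x - y) = windowRemainder f x y / (x - y)
        + (Icc (x - 1) (x + 1)).indicator (fun _ => f x) y / (x - y) := fun y => by
      rw [windowRemainder]; ring
    simp_rw [e]
    rw [integral_add hq.integrableOn (integrableOn_div_sub_of_le_abs (integrable_window _) hε
      (hms ε) fun _ h => h), setIntegral_window_div_eq_zero, add_zero]
  refine Tendsto.congr' (eventually_mem_nhdsWithin.mono heq) ?_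
  refine tendsto_integral_filter_of_dominated_convergence
    (fun y => ‖windowRemainder f x y / (x - y)‖)
    (.of_forall fun ε => (hq.indicator (hms ε)).aestronglyMeasurable)
    (.of_forall fun ε => .of_forall fun y => norm_indicator_le_norm_self _ _) hq.norm ?_
  filter_upwards [compl_mem_ae_iff.2 (measure_singleton x)] with y hy
  have hpos : 0 < |x - y| := abs_pos.2 (sub_ne_zero.2 fun h => hy h.symm)
  refine tendsto_const_nhds.congr' ?_
  filter_upwards [nhdsWithin_le_nhds (Iio_mem_nhds hpos)] with ε hε
  have hm : y ∈ {y | ε ≤ |x - y|} := le_of_lt (mem_Iio.1 hε)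
  rw [indicator_of_mem hm]

theorem hilbertExistsAt_of_differentiableAt (hf : Integrable f) (hx : DifferentiableAt ℝ f x) :
    HilbertExistsAt f x :=
  ⟨fun ε hε => ⟨integrableOn_div_sub_of_le_abs hf hε measurableSet_Iic fun y hy =>
      le_abs.2 (Or.inl (by simp only [mem_Iic] at hy; linarith)),
    integrableOn_div_sub_of_le_abs hf hε measurableSet_Ici fun y hy =>
      le_abs.2 (Or.inr (by simp only [mem_Ici] at hy; linarith))⟩,
    _, tendsto_truncatedHilbert hf hx⟩

theorem pi_mul_hilbertTransform (hf : Integrable f) (hx : DifferentiableAt ℝ f x) :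
    Real.pi * hilbertTransform f x = ∫ y, windowRemainder f x y / (x - y) := by
  rw [hilbertTransform, (tendsto_truncatedHilbert hf hx).limUnder_eq]
  field_simp

theorem norm_sub_le_norm_add_I_sub (x ε y : ℝ) :
    |x - y| ≤ ‖(x : ℂ) + ε * Complex.I - (y : ℂ)‖ := by
  simpa using Complex.abs_re_le_norm ((x : ℂ) + ε * Complex.I - y)

theorem add_I_sub_ne_zero {ε : ℝ} (hε : 0 < ε) (x y : ℝ) :
    (x : ℂ) + ε * Complex.I - (y : ℂ) ≠ 0 := by
  intro h
  have := congrArg Complex.im h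
  simp at this
  exact hε.ne' this

theorem intervalIntegral_one_div_add_I_sub {ε : ℝ} (hε : 0 < ε) :
    ∫ y in (x - 1)..(x + 1), 1 / ((x : ℂ) + ε * Complex.I - (y : ℂ))
      = Complex.log (1 + ε * Complex.I) - Complex.log (-1 + ε * Complex.I) := by
  have hder : ∀ y : ℝ, HasDerivAt
      (fun y : ℝ => -Complex.log ((x : ℂ) + ε * Complex.I - (y : ℂ)))
      (1 / ((x : ℂ) + ε * Complex.I - (y : ℂ))) y := fun y => by
    have h1 : HasDerivAt (fun y : ℝ => (x : ℂ) + ε * Complex.I - (y : ℂ)) (-1) y :=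
      (Complex.ofRealCLM.hasDerivAt (x := y)).const_sub _
    have h2 : (x : ℂ) + ε * Complex.I - (y : ℂ) ∈ Complex.slitPlane :=
      Complex.mem_slitPlane_iff.2 (Or.inr (by simpa using hε.ne'))
    have h3 := (h1.clog_real h2).neg
    rwa [neg_div, neg_neg] at h3
  have hcont : Continuous fun y : ℝ => 1 / ((x : ℂ) + ε * Complex.I - (y : ℂ)) :=
    continuous_const.div (by fun_prop) (add_I_sub_ne_zero hε x)
  rw [intervalIntegral.integral_eq_sub_of_hasDerivAt (fun y _ => hder y)
    (hcont.intervalIntegrable _ _)]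
  have e1 : (x : ℂ) + ε * Complex.I - ((x + 1 : ℝ) : ℂ) = -1 + ε * Complex.I := by
    push_cast; ring
  have e2 : (x : ℂ) + ε * Complex.I - ((x - 1 : ℝ) : ℂ) = 1 + ε * Complex.I := by
    push_cast; ring
  rw [e1, e2]
  ring

theorem tendsto_log_sub_log :
    Tendsto (fun ε : ℝ => Complex.log (1 + ε * Complex.I) - Complex.log (-1 + ε * Complex.I))
      (𝓝[>] 0) (𝓝 (-(Real.pi * Complex.I))) := by
  have h1 : Tendsto (fun ε : ℝ => Complex.log (1 + ε * Complex.I)) (𝓝[>] 0) (𝓝 0) := by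
    have hc : ContinuousAt (fun ε : ℝ => Complex.log (1 + ε * Complex.I)) 0 := by
      refine ContinuousAt.clog (by fun_prop) ?_
      simp
    have := hc.tendsto
    simp only [Complex.ofReal_zero, zero_mul, add_zero, Complex.log_one] at this
    exact this.mono_left nhdsWithin_le_nhds
  have h2 : Tendsto (fun ε : ℝ => Complex.log (-1 + ε * Complex.I)) (𝓝[>] 0)
      (𝓝 (Real.pi * Complex.I)) := by
    have hl := Complex.tendsto_log_nhdsWithin_im_nonneg_of_re_neg_of_im_zero (z := -1)
      (by simp) (by simp)
    simp only [norm_neg, norm_one, Real.log_one, Complex.ofReal_zero, zero_add] at hl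
    refine hl.comp (tendsto_nhdsWithin_iff.2 ⟨?_, ?_⟩)
    · have : Continuous fun ε : ℝ => (-1 : ℂ) + ε * Complex.I := by fun_prop
      have := this.tendsto 0
      simp only [Complex.ofReal_zero, zero_mul, add_zero] at this
      exact this.mono_left nhdsWithin_le_nhds
    · filter_upwards [self_mem_nhdsWithin] with ε hε
      simpa using le_of_lt (mem_Ioi.1 hε)
  simpa using h1.sub h2

/-- The Plemelj formula for the boundary value of the Stieltjes transform from above, at a point
where the density is differentiable. -/
theorem tendsto_integral_mul_one_div_add_I_sub (hf : Integrable f)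
    (hx : DifferentiableAt ℝ f x) :
    Tendsto (fun ε : ℝ => ∫ y, (f y : ℂ) * (1 / ((x : ℂ) + ε * Complex.I - (y : ℂ))))
      (𝓝[>] 0) (𝓝 (Real.pi * (hilbertTransform f x - Complex.I * f x))) := by
  have hq := integrable_windowRemainder_div hf hx
  have hr := integrable_windowRemainder (x := x) hf
  have hcont : ∀ ε : ℝ, 0 < ε → Continuous fun y : ℝ =>
      1 / ((x : ℂ) + ε * Complex.I - (y : ℂ)) := fun ε hε =>
    continuous_const.div (by fun_prop) (add_I_sub_ne_zero hε x)
  have hbound : ∀ ε : ℝ, ∀ y, ‖(windowRemainder f x y : ℂ) *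
      (1 / ((x : ℂ) + ε * Complex.I - (y : ℂ)))‖ ≤ ‖windowRemainder f x y / (x - y)‖ := by
    intro ε y
    rcases eq_or_ne y x with rfl | hy
    · simp [windowRemainder_self]
    · rw [mul_one_div, norm_div, norm_div, Complex.norm_real]
      exact div_le_div_of_nonneg_left (norm_nonneg _) (abs_pos.2 (sub_ne_zero.2 hy.symm))
        (norm_sub_le_norm_add_I_sub x ε y)
  have hmeas : ∀ ε : ℝ, 0 < ε → AEStronglyMeasurable (fun y => (windowRemainder f x y : ℂ) *
      (1 / ((x : ℂ) + ε * Complex.I - (y : ℂ)))) := fun ε hε =>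
    hr.ofReal.aestronglyMeasurable.mul (hcont ε hε).aestronglyMeasurable
  have hrem : Tendsto (fun ε : ℝ => ∫ y, (windowRemainder f x y : ℂ) *
      (1 / ((x : ℂ) + ε * Complex.I - (y : ℂ)))) (𝓝[>] 0)
      (𝓝 ((Real.pi * hilbertTransform f x : ℝ) : ℂ)) := by
    rw [pi_mul_hilbertTransform hf hx, ← integral_complex_ofReal]
    refine tendsto_integral_filter_of_dominated_convergence
      (fun y => ‖windowRemainder f x y / (x - y)‖)
      (eventually_mem_nhdsWithin.mono fun ε hε => hmeas ε hε)
      (.of_forall fun ε => .of_forall (hbound ε)) hq.norm ?_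
    filter_upwards [compl_mem_ae_iff.2 (measure_singleton x)] with y hy
    have hne : (x : ℂ) - y ≠ 0 := by
      rw [← Complex.ofReal_sub]
      exact_mod_cast sub_ne_zero.2 fun h => hy h.symm
    have hc : ContinuousAt (fun ε : ℝ => (windowRemainder f x y : ℂ) *
        (1 / ((x : ℂ) + ε * Complex.I - (y : ℂ)))) 0 := by
      refine continuousAt_const.mul (continuousAt_const.div (by fun_prop) ?_)
      simpa using hne
    have := hc.tendsto.mono_left (nhdsWithin_le_nhds (s := Ioi 0))
    simpa [div_eq_mul_inv] using this
  have hwin : ∀ ε ∈ Ioi (0 : ℝ), ∫ y, (f y : ℂ) * (1 / ((x : ℂ) + ε * Complex.I - (y : ℂ)))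
      = (∫ y, (windowRemainder f x y : ℂ) * (1 / ((x : ℂ) + ε * Complex.I - (y : ℂ))))
        + f x * (Complex.log (1 + ε * Complex.I) - Complex.log (-1 + ε * Complex.I)) := by
    intro ε hε
    have hI : Integrable ((Icc (x - 1) (x + 1)).indicator fun y : ℝ =>
        (f x : ℂ) * (1 / ((x : ℂ) + ε * Complex.I - (y : ℂ)))) :=
      (integrable_indicator_iff measurableSet_Icc).2
        (((hcont ε hε).const_mul _).continuousOn.integrableOn_compact isCompact_Icc)
    have h1 : Integrable fun y => (windowRemainder f x y : ℂ) *
        (1 / ((x : ℂ) + ε * Complex.I - (y : ℂ))) :=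
      hq.norm.mono' (hmeas ε hε) (.of_forall (hbound ε))
    rw [← intervalIntegral_one_div_add_I_sub hε, intervalIntegral.integral_of_le
        (show x - 1 ≤ x + 1 by linarith),
      ← integral_Icc_eq_integral_Ioc, ← integral_const_mul, ← integral_indicator measurableSet_Icc,
      ← integral_add h1 hI]
    refine integral_congr_ae (.of_forall fun y => ?_)
    simp only [windowRemainder, indicator_apply]
    split_ifs
    · push_cast; ring
    · simp
  have htot := hrem.add (tendsto_log_sub_log.const_mul (f x : ℂ))
  rw [show ((Real.pi * hilbertTransform f x : ℝ) : ℂ) + f x * -(Real.pi * Complex.I)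
    = Real.pi * (hilbertTransform f x - Complex.I * f x) by push_cast; ring] at htot
  exact htot.congr' (eventually_mem_nhdsWithin.mono fun ε hε => (hwin ε hε).symm)

end Plemelj

/-! ### Boundary values of the transform and their derivatives -/

/-- The value `π (H f - i f)` that the Stieltjes transform of the density `f` takes on the real
line, approached from above. -/
noncomputable def boundaryValue (f : ℝ → ℝ) (x : ℝ) : ℂ :=
  Real.pi * (hilbertTransform f x - Complex.I * f x)

theorem boundaryValue_re (f : ℝ → ℝ) (x : ℝ) :
    (boundaryValue f x).re = Real.pi * hilbertTransform f x := by
  simp [boundaryValue]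

theorem boundaryValue_im (f : ℝ → ℝ) (x : ℝ) : (boundaryValue f x).im = -(Real.pi * f x) := by
  simp [boundaryValue]

theorem mul_hilbertTransform_eq (f : ℝ → ℝ) (x : ℝ) :
    f x * hilbertTransform f x = -(boundaryValue f x ^ 2).im / (2 * Real.pi ^ 2) := by
  have hpi := Real.pi_ne_zero
  rw [sq, Complex.mul_im, boundaryValue_re, boundaryValue_im]
  field_simp
  ring

theorem integrable_of_isProbabilityMeasure_withDensity {f : ℝ → ℝ} (hm : AEStronglyMeasurable f)
    (h0 : ∀ x, 0 ≤ f x)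
    (hp : IsProbabilityMeasure (volume.withDensity fun x => ENNReal.ofReal (f x))) :
    Integrable f := by
  refine ⟨hm, (hasFiniteIntegral_iff_ofReal (.of_forall h0)).2 ?_⟩
  have := hp.measure_univ
  rw [withDensity_apply _ MeasurableSet.univ, Measure.restrict_univ] at this
  simp [this]

theorem stieltjes_withDensity {f : ℝ → ℝ} (hm : AEStronglyMeasurable f) (h0 : ∀ x, 0 ≤ f x)
    (z : ℂ) :
    stieltjes (volume.withDensity fun x => ENNReal.ofReal (f x)) z
      = ∫ y, (f y : ℂ) * (1 / (z - (y : ℂ))) := by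
  rw [stieltjes, integral_withDensity_eq_integral_toReal_smul₀ hm.aemeasurable.ennreal_ofReal
    (.of_forall fun _ => ENNReal.ofReal_lt_top)]
  simp [h0]

theorem tendsto_stieltjes_boundaryValue {f : ℝ → ℝ} {x : ℝ} (hf : Integrable f)
    (h0 : ∀ x, 0 ≤ f x) (hx : DifferentiableAt ℝ f x) :
    Tendsto (fun ε : ℝ => stieltjes (volume.withDensity fun x => ENNReal.ofReal (f x))
      ((x : ℂ) + ε * Complex.I)) (𝓝[>] 0) (𝓝 (boundaryValue f x)) := by
  simp_rw [stieltjes_withDensity hf.aestronglyMeasurable h0]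
  exact tendsto_integral_mul_one_div_add_I_sub hf hx

theorem HasStrictDerivAt.exists_local_right_inverse {f : ℂ → ℂ} {f' a : ℂ}
    (hf : HasStrictDerivAt f f' a) (hf' : f' ≠ 0) :
    ∃ g : ℂ → ℂ, g (f a) = a ∧ HasDerivAt g f'⁻¹ (f a) ∧ ∀ᶠ y in 𝓝 (f a), f (g y) = y :=
  ⟨hf.localInverse f f' a hf', (hf.hasStrictFDerivAt_equiv hf').localInverse_apply_image,
    (hf.to_localInverse hf').hasDerivAt,
    (hf.hasStrictFDerivAt_equiv hf').eventually_right_inverse⟩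

theorem sub_mul_im_pos {x t : ℝ} {b : ℂ} (ht : 0 < t) (hb : b.im < 0) :
    0 < ((x : ℂ) - t * b).im := by
  rw [Complex.sub_im, Complex.im_ofReal_mul, Complex.ofReal_im]
  nlinarith

section Boundary

variable {ν : Measure ℝ} [IsProbabilityMeasure ν]

/-- The relation `S (z - t G z) = G z` passes to boundary values with negative imaginary part. -/
theorem stieltjes_sub_mul_eq_of_tendsto {G : ℂ → ℂ} {t x : ℝ} {b : ℂ} (ht : 0 < t)
    (hb : b.im < 0) (hG : ∀ z : ℂ, 0 < z.im → G z = stieltjes ν (z - t * G z))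
    (hlim : Tendsto (fun ε : ℝ => G ((x : ℂ) + ε * Complex.I)) (𝓝[>] 0) (𝓝 b)) :
    stieltjes ν (x - t * b) = b := by
  have hx : Tendsto (fun ε : ℝ => (x : ℂ) + ε * Complex.I) (𝓝[>] 0) (𝓝 x) := by
    have hc : Continuous fun ε : ℝ => (x : ℂ) + ε * Complex.I := by fun_prop
    have := (hc.tendsto 0).mono_left (nhdsWithin_le_nhds (s := Ioi 0))
    simpa using this
  have hc := (hasDerivAt_stieltjes (ν := ν) (sub_mul_im_pos (x := x) ht hb).ne').continuousAt
  have h1 := hc.tendsto.comp (hx.sub (hlim.const_mul (t : ℂ)))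
  refine tendsto_nhds_unique (h1.congr' ?_) hlim
  filter_upwards [self_mem_nhdsWithin] with ε hε
  exact (hG _ (by simpa using hε)).symm

theorem norm_le_of_tendsto {G : ℂ → ℂ} {t x : ℝ} {b : ℂ} (ht : 0 < t)
    (hG : ∀ z : ℂ, 0 < z.im → 0 < (z - t * G z).im ∧ G z = stieltjes ν (z - t * G z))
    (hlim : Tendsto (fun ε : ℝ => G ((x : ℂ) + ε * Complex.I)) (𝓝[>] 0) (𝓝 b)) :
    ‖b‖ ≤ (1 + 1 / t) / 2 := by
  refine le_of_tendsto hlim.norm ?_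
  filter_upwards [self_mem_nhdsWithin] with ε hε
  have hz : 0 < ((x : ℂ) + ε * Complex.I).im := by simpa using hε
  obtain ⟨h1, h2⟩ := hG _ hz
  have h3 := norm_stieltjes_le_of_im_nonneg (ν := ν) ht h1
    (by rw [← h2, sub_add_cancel]; exact hz.le)
  rwa [← h2] at h3

/-- Derivative in `x` of a solution `b` of `S (x - t b) = b`, from the inverse function theorem
for `w ↦ w + t S w`. -/
theorem hasDerivAt_space_of_stieltjes_eq {b : ℝ → ℂ} {t x₀ : ℝ} (ht : 0 < t)
    (hb : ∀ᶠ x in 𝓝 x₀, (b x).im < 0 ∧ stieltjes ν (x - t * b x) = b x) :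
    HasDerivAt b (-stieltjesSlope ν (x₀ - t * b x₀) (x₀ - t * b x₀) /
      (1 - t * stieltjesSlope ν (x₀ - t * b x₀) (x₀ - t * b x₀))) x₀ := by
  obtain ⟨hb1, hb2⟩ := hb.self_of_nhds
  have hw := sub_mul_im_pos (x := x₀) ht hb1
  set w₀ : ℂ := x₀ - t * b x₀ with hw₀
  set σ := stieltjesSlope ν w₀ w₀ with hσ
  have hfw : w₀ + t * stieltjes ν w₀ = x₀ := by rw [hb2, hw₀]; ring
  have hne : 1 - t * σ ≠ 0 :=
    one_sub_mul_stieltjesSlope_ne_zero ht hw (by rw [hfw, Complex.ofReal_im])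
  have hf : HasStrictDerivAt (fun w : ℂ => w + t * stieltjes ν w) (1 - t * σ) w₀ := by
    have := (hasStrictDerivAt_id w₀).add ((hasStrictDerivAt_stieltjes (ν := ν) hw).const_mul (t : ℂ))
    rwa [mul_neg, ← sub_eq_add_neg] at this
  obtain ⟨g, hg1, hg2, hg3⟩ := hf.exists_local_right_inverse hne
  simp only [hfw] at hg1 hg2 hg3
  have hgr : HasDerivAt (fun x : ℝ => g x) (1 - t * σ)⁻¹ x₀ := hg2.comp_ofReal
  have hpos : ∀ᶠ x : ℝ in 𝓝 x₀, 0 < (g x).im :=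
    (Complex.continuous_im.continuousAt.comp hgr.continuousAt).eventually
      (lt_mem_nhds (by simpa [hg1] using hw))
  have hinv : ∀ᶠ x : ℝ in 𝓝 x₀, g x + t * stieltjes ν (g x) = x :=
    (Complex.continuous_ofReal.tendsto x₀).eventually hg3
  have ht0 : (t : ℂ) ≠ 0 := by exact_mod_cast ht.ne'
  have heq : b =ᶠ[𝓝 x₀] fun x : ℝ => ((x : ℂ) - g x) / t := by
    filter_upwards [hb, hpos, hinv] with x hx1 hx2 hx3
    have hw := sub_mul_im_pos (x := x) ht hx1.1
    have := add_mul_stieltjes_inj (ν := ν) ht hx2 hw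
      (by rw [hx3, hx1.2]; ring) (by rw [hx3, Complex.ofReal_im])
    rw [this]
    field_simp
    ring
  have hd := ((Complex.ofRealCLM.hasDerivAt (x := x₀)).sub hgr).div_const (t : ℂ)
  refine (hd.congr_of_eventuallyEq heq).congr_deriv ?_
  simp only [Complex.ofRealCLM_apply, Complex.ofReal_one]
  field_simp
  ring

/-- Derivative in `t` of a solution `b` of `S (x - t b) = b`, from the inverse function theorem
for `w ↦ (x - w) / S w`, whose value at `x - t b` is `t`. -/
theorem hasDerivAt_time_of_stieltjes_eq {b : ℝ → ℂ} {t₀ x : ℝ} (ht₀ : 0 < t₀)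
    (hb : ∀ᶠ t in 𝓝 t₀, (b t).im < 0 ∧ stieltjes ν (x - t * b t) = b t) :
    HasDerivAt b (stieltjesSlope ν (x - t₀ * b t₀) (x - t₀ * b t₀) * b t₀ /
      (1 - t₀ * stieltjesSlope ν (x - t₀ * b t₀) (x - t₀ * b t₀))) t₀ := by
  obtain ⟨hb1, hb2⟩ := hb.self_of_nhds
  have hw := sub_mul_im_pos (x := x) ht₀ hb1
  set w₀ : ℂ := x - t₀ * b t₀ with hw₀
  set σ := stieltjesSlope ν w₀ w₀ with hσ
  have hfw : w₀ + t₀ * stieltjes ν w₀ = x := by rw [hb2, hw₀]; ring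
  have hne : 1 - t₀ * σ ≠ 0 :=
    one_sub_mul_stieltjesSlope_ne_zero ht₀ hw (by rw [hfw, Complex.ofReal_im])
  have hb0 : b t₀ ≠ 0 := fun h => by simp [h] at hb1
  have hS := hasStrictDerivAt_stieltjes (ν := ν) hw
  have hK : HasStrictDerivAt (fun w : ℂ => (x - w) / stieltjes ν w)
      (-(1 - t₀ * σ) / b t₀) w₀ := by
    have := ((hasStrictDerivAt_id w₀).const_sub (x : ℂ)).div hS (by rwa [hb2])
    refine this.congr_deriv ?_
    simp only [hb2, id, ← hσ]
    rw [hw₀]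
    field_simp
    ring
  have hKw : (x - w₀) / stieltjes ν w₀ = t₀ := by
    rw [hb2, hw₀]; field_simp; ring
  obtain ⟨g, hg1, hg2, hg3⟩ := hK.exists_local_right_inverse (div_ne_zero (neg_ne_zero.2 hne) hb0)
  simp only [hKw] at hg1 hg2 hg3
  have hgr : HasDerivAt (fun t : ℝ => g t) (-(1 - t₀ * σ) / b t₀)⁻¹ t₀ := hg2.comp_ofReal
  have hpos : ∀ᶠ t : ℝ in 𝓝 t₀, 0 < (g t).im :=
    (Complex.continuous_im.continuousAt.comp hgr.continuousAt).eventually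
      (lt_mem_nhds (by simpa [hg1] using hw))
  have hinv : ∀ᶠ t : ℝ in 𝓝 t₀, (x - g t) / stieltjes ν (g t) = t :=
    (Complex.continuous_ofReal.tendsto t₀).eventually hg3
  have heq : b =ᶠ[𝓝 t₀] fun t : ℝ => stieltjes ν (g t) := by
    filter_upwards [hb, hpos, hinv, lt_mem_nhds ht₀] with t hx1 hx2 hx3 ht
    have hw := sub_mul_im_pos (x := x) ht hx1.1
    have ht0 : (t : ℂ) ≠ 0 := by exact_mod_cast ht.ne'
    -- a zero of the transform would make the quotient `0` instead of `t`
    have hS0 : stieltjes ν (g t) ≠ 0 := fun h => ht0 (by rw [← hx3, h, div_zero])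
    have hx4 : g t + t * stieltjes ν (g t) = x := by
      rw [div_eq_iff hS0] at hx3
      rw [← hx3]; ring
    have := add_mul_stieltjes_inj (ν := ν) ht hx2 hw
      (by rw [hx4, hx1.2]; ring) (by rw [hx4, Complex.ofReal_im])
    rw [this, hx1.2]
  have hS' : HasDerivAt (stieltjes ν) (-σ) (g t₀) := hg1.symm ▸ hS.hasDerivAt
  have hd := hS'.comp t₀ hgr
  refine (hd.congr_of_eventuallyEq heq).congr_deriv ?_
  field_simp

end Boundary

/-! ### The equation for the density -/

/-- The imaginary part of the Burgers equation for the boundary values `b = π (H ρ - i ρ)`. -/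
theorem density_equation_of_boundaryValue {ρ : ℝ → ℝ → ℝ} {t x : ℝ} {bt bx : ℂ}
    (ht : HasDerivAt (fun s => boundaryValue (ρ s) x) bt t)
    (hx : HasDerivAt (boundaryValue (ρ t)) bx x)
    (h : bt + boundaryValue (ρ t) x * bx = 0) :
    DifferentiableAt ℝ (fun y => ρ t y * hilbertTransform (ρ t) y) x ∧
      deriv (fun s => ρ s x) t
        + Real.pi * deriv (fun y => ρ t y * hilbertTransform (ρ t) y) x = 0 := by
  have hpi := Real.pi_ne_zero
  have h1 : HasDerivAt (fun s => ρ s x) (-bt.im / Real.pi) t := by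
    have h2 := ((Complex.imCLM.hasFDerivAt.comp_hasDerivAt t ht).neg.div_const Real.pi)
    refine h2.congr_of_eventuallyEq (.of_forall fun s => ?_)
    simp only [Pi.neg_apply, Function.comp_apply, Complex.imCLM_apply, boundaryValue_im]
    field_simp
  have h2 : HasDerivAt (fun y => ρ t y * hilbertTransform (ρ t) y)
      (-(2 * boundaryValue (ρ t) x * bx).im / (2 * Real.pi ^ 2)) x := by
    have h3 := (Complex.imCLM.hasFDerivAt.comp_hasDerivAt x (hx.pow 2)).neg.div_const
      (2 * Real.pi ^ 2)
    refine (h3.congr_of_eventuallyEq (.of_forall fun y => ?_)).congr_deriv ?_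
    · simp [mul_hilbertTransform_eq]
    · simp
  refine ⟨h2.differentiableAt, ?_⟩
  rw [h1.deriv, h2.deriv]
  have h4 := congrArg Complex.im h
  rw [Complex.add_im, Complex.zero_im] at h4
  rw [mul_assoc, show (2 * (boundaryValue (ρ t) x * bx)).im
    = 2 * (boundaryValue (ρ t) x * bx).im by simp]
  field_simp
  linarith

/-- At a zero of the density both terms vanish: the zero is a minimum in `t` and in `x`, and the
Hilbert transform is bounded near it. -/
theorem density_equation_of_eq_zero {ρ : ℝ → ℝ → ℝ} {t x C : ℝ} (h0 : ρ t x = 0)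
    (ht : ∀ᶠ s in 𝓝 t, 0 ≤ ρ s x) (hx : ∀ y, 0 ≤ ρ t y) (hd : DifferentiableAt ℝ (ρ t) x)
    (hC : ∀ᶠ y in 𝓝 x, |hilbertTransform (ρ t) y| ≤ C) :
    DifferentiableAt ℝ (fun y => ρ t y * hilbertTransform (ρ t) y) x ∧
      deriv (fun s => ρ s x) t
        + Real.pi * deriv (fun y => ρ t y * hilbertTransform (ρ t) y) x = 0 := by
  have hmt : IsLocalMin (fun s => ρ s x) t := ht.mono fun s hs => by simpa [h0] using hs
  have hmx : IsLocalMin (ρ t) x := .of_forall fun y => by simpa [h0] using hx y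
  have hρ : HasDerivAt (ρ t) 0 x := by simpa [hmx.deriv_eq_zero] using hd.hasDerivAt
  have hprod : HasDerivAt (fun y => ρ t y * hilbertTransform (ρ t) y) 0 x := by
    rw [hasDerivAt_iff_isLittleO] at hρ ⊢
    simp only [h0, smul_zero, sub_zero, zero_mul] at hρ ⊢
    have hO : hilbertTransform (ρ t) =O[𝓝 x] fun _ => (1 : ℝ) :=
      Asymptotics.IsBigO.of_bound C (hC.mono fun y hy => by simpa using hy)
    simpa using hρ.mul_isBigO hO
  refine ⟨hprod.differentiableAt, ?_⟩
  rw [hmt.deriv_eq_zero, hprod.deriv, mul_zero, add_zero]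

theorem theorem2 (μ : ℝ → Measure ℝ) (ρ : ℝ → ℝ → ℝ) (U : Set (ℝ × ℝ))
    (hμ : ∀ t : ℝ, 0 ≤ t → IsProbabilityMeasure (μ t))
    (hρ_nonneg : ∀ t x : ℝ, 0 < t → 0 ≤ ρ t x)
    (hρ_density : ∀ t : ℝ, 0 < t → μ t = volume.withDensity fun x => ENNReal.ofReal (ρ t x))
    (hC1 : PiecewiseDifferentiable ρ U)
    (hC2 : DensityInLp ρ U)
    (hG : SolvesComplexBurgers (greenFunction μ)) :
    (∀ t x : ℝ, (t, x) ∈ U →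
      HilbertExistsAt (ρ t) x ∧
      DifferentiableAt ℝ (fun y => ρ t y * hilbertTransform (ρ t) y) x ∧
      deriv (fun s => ρ s x) t
        + Real.pi * deriv (fun y => ρ t y * hilbertTransform (ρ t) y) x = 0) ∧
    (∀ (t : ℝ) (z : ℂ), 0 ≤ t → z.im ≠ 0 →
      (z - (t : ℂ) * greenFunction μ t z).im ≠ 0 ∧
      greenFunction μ t z = greenFunction μ 0 (z - (t : ℂ) * greenFunction μ t z)) := by
  have hμ0 := hμ 0 le_rfl
  refine ⟨fun t x htx => ?_, fun t z ht hz => ?_⟩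
  swap
  · have := hμ t ht
    exact ⟨abs_pos.1 ((abs_pos.2 hz).trans_le (abs_im_le_abs_im_characteristic hz ht)),
      stieltjes_eq_stieltjes_zero hμ hG ht hz⟩
  have hpos : ∀ {s y : ℝ}, (s, y) ∈ U → 0 < s := fun h => (hC1.subset h).1
  have hint : ∀ s, 0 < s → Integrable (ρ s) := fun s hs => by
    obtain ⟨p, -, -, hp, -⟩ := hC2 s hs
    exact integrable_of_isProbabilityMeasure_withDensity hp.1 (fun y => hρ_nonneg s y hs)
      (hρ_density s hs ▸ hμ s hs.le)
  have hchar : ∀ s, 0 < s → ∀ z : ℂ, 0 < z.im → 0 < (z - s * stieltjes (μ s) z).im ∧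
      stieltjes (μ s) z = stieltjes (μ 0) (z - s * stieltjes (μ s) z) := fun s hs z hz => by
    have := hμ s hs.le
    refine ⟨?_, stieltjes_eq_stieltjes_zero hμ hG hs.le hz.ne'⟩
    have hE : 0 ≤ stieltjesEnergy (μ s) z := stieltjesEnergy_nonneg z
    rw [Complex.sub_im, Complex.im_ofReal_mul, stieltjes_im hz.ne']
    nlinarith [mul_nonneg hs.le (mul_nonneg hz.le hE)]
  have hlim : ∀ {s y : ℝ}, (s, y) ∈ U →
      Tendsto (fun ε : ℝ => stieltjes (μ s) ((y : ℂ) + ε * Complex.I)) (𝓝[>] 0)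
        (𝓝 (boundaryValue (ρ s) y)) := fun {s y} h => by
    rw [hρ_density s (hpos h)]
    exact tendsto_stieltjes_boundaryValue (hint s (hpos h)) (fun y => hρ_nonneg s y (hpos h))
      (hC1.differentiable_space s y h)
  have hsol : ∀ {s y : ℝ}, (s, y) ∈ U → 0 < ρ s y → (boundaryValue (ρ s) y).im < 0 ∧
      stieltjes (μ 0) (y - s * boundaryValue (ρ s) y) = boundaryValue (ρ s) y :=
    fun {s y} h hρ => by
      have hb : (boundaryValue (ρ s) y).im < 0 := by
        rw [boundaryValue_im]; exact neg_neg_of_pos (mul_pos Real.pi_pos hρ)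
      exact ⟨hb, stieltjes_sub_mul_eq_of_tendsto (hpos h) hb
        (fun z hz => (hchar s (hpos h) z hz).2) (hlim h)⟩
  have ht := hpos htx
  have hUx : ∀ᶠ y in 𝓝 x, (t, y) ∈ U :=
    (Continuous.prodMk_right t).continuousAt.eventually (hC1.isOpen.mem_nhds htx)
  have hUt : ∀ᶠ s in 𝓝 t, (s, x) ∈ U :=
    (Continuous.prodMk_left x).continuousAt.eventually (hC1.isOpen.mem_nhds htx)
  have hdx := hC1.differentiable_space t x htx
  have hdt := hC1.differentiable_time t x htx
  refine ⟨hilbertExistsAt_of_differentiableAt (hint t ht) hdx, ?_⟩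
  rcases (hρ_nonneg t x ht).eq_or_lt with h0 | h0
  · refine density_equation_of_eq_zero (C := (1 + 1 / t) / 2 / Real.pi) h0.symm
      (hUt.mono fun s hs => hρ_nonneg s x (hpos hs)) (fun y => hρ_nonneg t y ht) hdx
      (hUx.mono fun y hy => ?_)
    have h1 := norm_le_of_tendsto ht (hchar t ht) (hlim hy)
    have h2 := (Complex.abs_re_le_norm _).trans h1
    rw [boundaryValue_re, abs_mul, abs_of_pos Real.pi_pos] at h2
    rw [le_div_iff₀ Real.pi_pos]
    linarith
  · have hx := hasDerivAt_space_of_stieltjes_eq (ν := μ 0) (b := boundaryValue (ρ t)) ht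
      ((hUx.and (hdx.continuousAt.eventually (lt_mem_nhds h0))).mono fun y hy => hsol hy.1 hy.2)
    have ht' := hasDerivAt_time_of_stieltjes_eq (ν := μ 0) (x := x)
      (b := fun s => boundaryValue (ρ s) x) ht
      ((hUt.and (hdt.continuousAt.eventually (lt_mem_nhds h0))).mono fun s hs => hsol hs.1 hs.2)
    exact density_equation_of_boundaryValue ht' hx (by ring)
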